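/- Let $G$ be a finite simple graph (no loops or multiple edges), with $d(v)$ denoting the degree of a vertex $v$ and $\Delta=\Delta(G)$ the maximum degree of $G$. A \emph{kite} in $G$ is a subgraph formed by two distinct 3-cycles that share an edge. If $G$ is planar, contains no kites, and $\Delta\ge 7$, then $G$ has an edge $uv$ with $d(u)\le 4$ and $d(u)+d(v)\le \Delta+2$. -/

import Mathlib

/-- `A` is a simple polygonal arc in the plane with endpoints `p` and `q`: there are points
`x 0 = p, x 1, …, x n = q`, with `n ≥ 1` and consecutive points distinct, such that `A` is the union
of the straight line segments `[x i, x (i + 1)]`, two consecutive segments meet only in their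
common endpoint, and any two other segments are disjoint. (In particular `p ≠ q`.) -/
def IsPolygonalArc (p q : ℝ × ℝ) (A : Set (ℝ × ℝ)) : Prop :=
  ∃ (n : ℕ) (x : ℕ → ℝ × ℝ), 1 ≤ n ∧ x 0 = p ∧ x n = q ∧
    (∀ i, i < n → x i ≠ x (i + 1)) ∧
    (∀ i j, i < j → j < n → ∀ y,
      y ∈ segment ℝ (x i) (x (i + 1)) → y ∈ segment ℝ (x j) (x (j + 1)) →
        j = i + 1 ∧ y = x j) ∧
    A = {y | ∃ i, i < n ∧ y ∈ segment ℝ (x i) (x (i + 1))}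

namespace SimpleGraph

/-- A drawing of the graph `G` in the plane without crossings: distinct vertices are distinct
points, each edge is a simple polygonal arc joining its two endpoints and containing no other
vertex, and two distinct edges meet only in common endpoints. The value of `arc` on an unordered
pair that is not an edge of `G` plays no role. -/
structure PlaneDrawing {V : Type*} (G : SimpleGraph V) where
  point : V → ℝ × ℝ
  arc : Sym2 V → Set (ℝ × ℝ)
  point_injective : Function.Injective point
  isPolygonalArc : ∀ u v, G.Adj u v → IsPolygonalArc (point u) (point v) (arc s(u, v))
  vertex_mem_arc : ∀ e ∈ G.edgeSet, ∀ w, point w ∈ arc e → w ∈ e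
  arc_inter : ∀ e ∈ G.edgeSet, ∀ f ∈ G.edgeSet, e ≠ f →
    ∀ y, y ∈ arc e → y ∈ arc f → ∃ w, w ∈ e ∧ w ∈ f ∧ y = point w

/-- A graph is planar if it can be drawn in the plane without crossings. -/
def IsPlanar {V : Type*} (G : SimpleGraph V) : Prop :=
  Nonempty G.PlaneDrawing

/-- `G` contains a kite: two distinct 3-cycles `abc` and `abd` sharing the edge `ab`. -/
def ContainsKite {V : Type*} (G : SimpleGraph V) : Prop :=
  ∃ a b c d, c ≠ d ∧ G.Adj a b ∧ G.Adj a c ∧ G.Adj b c ∧ G.Adj a d ∧ G.Adj b d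

end SimpleGraph

/-! Discharging against a weak Euler bound. With `E` edges, `n` non-isolated vertices and `T`
triangles, planarity gives `2E ≤ 4n + T` (`IsPlanar.two_mul_card_edges_le`), so the sum of `6d(v) -
24` over these vertices is at most `6T`. Suppose every edge with an end of degree at most 4 has
degree sum at least `Δ + 3`. Then non-isolated vertices have degree at least 3, vertices of degree
at most 4 are independent, and neighbours of cubic vertices have degree `Δ`. Each vertex gives 2 to
every cubic neighbour and 0, 2 or 3 to every triangle through it, so that a triangle gets at least
6. Without kites, triangles at `v` meet only in `v`; hence every vertex can pay (`charge_le`), and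
one of degree at least 7 keeps 1. A vertex of degree `Δ` then contradicts the bound.

The Euler bound comes from MacLane's 2-basis, without the Jordan curve theorem. A face is
represented by the parities with which the cycles enclose it, read off along a vertical ray. The
values of a cycle `C` on the two sides of an arc `s` differ by `C s`, so face boundaries span the
cycle space (`sum_faces`), and they are themselves cycles (`boundary_faceBoundary`). A basis chosen
among them has at least `E - n` members and uses each edge at most twice; a member has at least four
edges or is a triangle. Hence `4(E - n) ≤ 2E + T`. -/

/-- A finite system of `x`-monotone arcs in the plane, meeting only in common endpoints: the arc `s`
is the graph of `h s` between the abscissas of its left end `l s` and its right end `r s`. -/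
structure MonotoneArcs (P S : Type*) where
  x : P → ℝ
  y : P → ℝ
  l : S → P
  r : S → P
  h : S → ℝ → ℝ
  x_injective : Function.Injective x
  x_lt : ∀ s, x (l s) < x (r s)
  continuous_h : ∀ s, Continuous (h s)
  h_left : ∀ s, h s (x (l s)) = y (l s)
  h_right : ∀ s, h s (x (r s)) = y (r s)
  inter : ∀ s t, s ≠ t → ∀ ξ, x (l s) ≤ ξ → ξ ≤ x (r s) → x (l t) ≤ ξ → ξ ≤ x (r t) →
    h s ξ = h t ξ → ∃ p, (p = l s ∨ p = r s) ∧ (p = l t ∨ p = r t) ∧ x p = ξ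

/-- Going down through the members of a finite set in decreasing order of height and adding up the
values `c`, every value `φ` is left as often as it is entered, up to the first and last value. -/
theorem Finset.sum_indicator_partial_sums {S M : Type*} [AddCommGroup M] [DecidableEq M]
    (k : S → ℝ) (c : S → M) (a φ : M) (R : Finset S) (hk : Set.InjOn k R) :
    ∑ s ∈ R, ((if a + ∑ t ∈ R with k s < k t, c t = φ then (1 : ZMod 2) else 0) +
        (if a + ∑ t ∈ R with k s < k t, c t + c s = φ then 1 else 0)) =
      (if a = φ then 1 else 0) + (if a + ∑ t ∈ R, c t = φ then 1 else 0) := by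
  classical
  induction R using Finset.induction_on_min_value k with
  | empty => simp [CharTwo.add_self_eq_zero]
  | insert s R hs hmin ih =>
    have hlt : ∀ t ∈ R, k s < k t := fun t ht => lt_of_le_of_ne (hmin t ht) fun h =>
      hs ((hk (by simp) (by simp [ht]) h) ▸ ht)
    have ih := ih (hk.mono (by simp))
    rw [Finset.sum_insert hs]
    have h1 : (insert s R).filter (fun t => k s < k t) = R := by
      ext t; simp only [Finset.mem_filter, Finset.mem_insert]
      constructor
      · rintro ⟨rfl | h, h'⟩
        · exact absurd h' (lt_irrefl _)
        · exact h
      · exact fun h => ⟨Or.inr h, hlt t h⟩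
    have h2 : ∀ u ∈ R, (insert s R).filter (fun t => k u < k t) = R.filter (fun t => k u < k t) := by
      intro u hu
      rw [Finset.filter_insert, if_neg (not_lt.2 (hmin u hu))]
    have h3 : ∑ u ∈ R, ((if a + ∑ t ∈ insert s R with k u < k t, c t = φ then (1 : ZMod 2) else 0) +
        (if a + ∑ t ∈ insert s R with k u < k t, c t + c u = φ then 1 else 0)) = _ :=
      (Finset.sum_congr rfl fun u hu => by rw [h2 u hu]).trans ih
    rw [h1, h3, Finset.sum_insert hs,
      add_comm (c s), ← add_assoc a]
    generalize (if a + ∑ t ∈ R, c t = φ then (1 : ZMod 2) else 0) = A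
    generalize (if a + ∑ t ∈ R, c t + c s = φ then (1 : ZMod 2) else 0) = B
    have := CharTwo.add_self_eq_zero A
    linear_combination this

/-! ### Relative position of monotone arcs -/

namespace MonotoneArcs

variable {P S : Type*} (A : MonotoneArcs P S)

/-- The abscissa `ξ` lies strictly between the ends of `s`. -/
def Over (s : S) (ξ : ℝ) : Prop := A.x (A.l s) < ξ ∧ ξ < A.x (A.r s)

/-- The abscissa `ξ` lies weakly between the ends of `s`. -/
def WeakOver (s : S) (ξ : ℝ) : Prop := A.x (A.l s) ≤ ξ ∧ ξ ≤ A.x (A.r s)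

theorem Over.weak {A : MonotoneArcs P S} {s : S} {ξ : ℝ} (h : A.Over s ξ) : A.WeakOver s ξ :=
  ⟨h.1.le, h.2.le⟩

theorem h_ne {s t : S} (hst : s ≠ t) {ξ : ℝ} (hs : A.Over s ξ) (ht : A.WeakOver t ξ) :
    A.h s ξ ≠ A.h t ξ := by
  intro h
  obtain ⟨p, hp | hp, -, hx⟩ := A.inter s t hst ξ hs.1.le hs.2.le ht.1 ht.2 h
  · subst hp; exact absurd hs.1 (by rw [hx]; exact lt_irrefl _)
  · subst hp; exact absurd hs.2 (by rw [hx]; exact lt_irrefl _)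

theorem lt_of_lt_of_ne_on {f g : ℝ → ℝ} (hf : Continuous f) (hg : Continuous g) {α β : ℝ}
    (hne : ∀ ξ ∈ Set.uIcc α β, f ξ ≠ g ξ) (h : f α < g α) : f β < g β := by
  by_contra hcon
  have h0 : (0 : ℝ) ∈ Set.uIcc ((fun ξ => g ξ - f ξ) α) ((fun ξ => g ξ - f ξ) β) := by
    rw [Set.mem_uIcc]
    right
    constructor <;> simp only <;> linarith
  obtain ⟨ξ, hξ, hξ0⟩ := intermediate_value_uIcc
    (f := fun ξ => g ξ - f ξ) (hg.sub hf).continuousOn h0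
  exact hne ξ hξ (by simp only at hξ0; linarith)

theorem lt_iff_lt_of_ne_on {f g : ℝ → ℝ} (hf : Continuous f) (hg : Continuous g) {α β : ℝ}
    (hne : ∀ ξ ∈ Set.uIcc α β, f ξ ≠ g ξ) : f α < g α ↔ f β < g β :=
  ⟨lt_of_lt_of_ne_on hf hg hne, lt_of_lt_of_ne_on hf hg (by rwa [Set.uIcc_comm])⟩

/-- The point `p` lies above `s`, strictly between the abscissas `ξ` and `ξ'`. -/
def Between (s : S) (ξ ξ' : ℝ) (p : P) : Prop :=
  (ξ < A.x p ∧ A.x p < ξ') ∧ A.h s (A.x p) < A.y p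

open Classical in
-- Inside the strip `t` cannot cross `s`, so each end of its part above `s` is on one of the two
-- vertical lines or is an end of `t`; these ends are even in number.
theorem above_add_above {s t : S} (hst : s ≠ t) {ξ ξ' : ℝ} (hlt : ξ < ξ')
    (hs : A.Over s ξ) (hs' : A.Over s ξ') (hξ : ∀ p, A.x p ≠ ξ) (hξ' : ∀ p, A.x p ≠ ξ') :
    (if A.Over t ξ ∧ A.h s ξ < A.h t ξ then (1 : ZMod 2) else 0) +
      (if A.Over t ξ' ∧ A.h s ξ' < A.h t ξ' then 1 else 0) =
    (if A.Between s ξ ξ' (A.l t) then 1 else 0) + (if A.Between s ξ ξ' (A.r t) then 1 else 0) := by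
  have hlr := A.x_lt t
  have hl := A.h_left t
  have hr := A.h_right t
  unfold Between
  rw [← hl, ← hr]
  rcases lt_or_gt_of_ne (hξ (A.r t)) with h1 | h1
  · rw [if_neg, if_neg, if_neg, if_neg]
    · rintro ⟨⟨_, _⟩, _⟩; linarith
    · rintro ⟨⟨_, _⟩, _⟩; linarith
    · rintro ⟨⟨_, _⟩, _⟩; linarith
    · rintro ⟨⟨_, _⟩, _⟩; linarith
  rcases lt_or_gt_of_ne (hξ' (A.l t)) with h2 | h2
  swap
  · rw [if_neg, if_neg, if_neg, if_neg]
    · rintro ⟨⟨_, _⟩, _⟩; linarith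
    · rintro ⟨⟨_, _⟩, _⟩; linarith
    · rintro ⟨⟨_, _⟩, _⟩; linarith
    · rintro ⟨⟨_, _⟩, _⟩; linarith
  have key : ∀ α β, α ≤ β → ξ ≤ α → β ≤ ξ' → A.x (A.l t) ≤ α → β ≤ A.x (A.r t) →
      (A.h s α < A.h t α ↔ A.h s β < A.h t β) := by
    intro α β hαβ h3 h4 h5 h6
    apply lt_iff_lt_of_ne_on (A.continuous_h s) (A.continuous_h t)
    intro ζ hζ
    rw [Set.uIcc_of_le hαβ] at hζ
    exact A.h_ne hst ⟨by linarith [hs.1, hζ.1], by linarith [hs'.2, hζ.2]⟩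
      ⟨by linarith [hζ.1], by linarith [hζ.2]⟩
  unfold Over
  rcases lt_or_gt_of_ne (hξ (A.l t)) with h3 | h3 <;>
  rcases lt_or_gt_of_ne (hξ' (A.r t)) with h4 | h4
  · have k := key ξ (A.x (A.r t)) (by linarith) (by linarith) (by linarith) (by linarith) (by linarith)
    simp [h1, h2, h3, h4, k, not_lt.2 h3.le, not_lt.2 h4.le]
  · have k := key ξ ξ' (by linarith) (by linarith) (by linarith) (by linarith) (by linarith)
    simp [h1, h2, h3, h4, k, not_lt.2 h3.le, not_lt.2 h4.le, CharTwo.add_self_eq_zero]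
  · have k := key (A.x (A.l t)) (A.x (A.r t)) (by linarith) (by linarith) (by linarith) (by linarith) (by linarith)
    simp [h1, h2, h3, h4, k, not_lt.2 h3.le, not_lt.2 h4.le, CharTwo.add_self_eq_zero]
  · have k := key (A.x (A.l t)) ξ' (by linarith) (by linarith) (by linarith) (by linarith) (by linarith)
    simp [h1, h2, h3, h4, k, not_lt.2 h3.le, not_lt.2 h4.le]

/-- No end of an arc other than `v` has its abscissa weakly between those of `v` and `ξ`. -/
def Near (v : P) (ξ : ℝ) : Prop :=
  ξ ≠ A.x v ∧ ∀ p, p ≠ v → (A.x p < A.x v ∧ A.x p < ξ) ∨ (A.x v < A.x p ∧ ξ < A.x p)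

theorem Near.ne {A : MonotoneArcs P S} {v : P} {ξ : ℝ} (h : A.Near v ξ) (p : P) : A.x p ≠ ξ := by
  by_cases hp : p = v
  · subst hp; exact h.1.symm
  · rcases h.2 p hp with h | h
    · exact h.2.ne
    · exact h.2.ne'

theorem x_ne {p q : P} (h : p ≠ q) : A.x p ≠ A.x q := fun h' => h (A.x_injective h')

theorem exists_between_ne [Finite P] {α β : ℝ} (h : α < β) :
    ∃ ξ, α < ξ ∧ ξ < β ∧ ∀ p, A.x p ≠ ξ := by
  have h1 : (Set.Ioo α β \ Set.range A.x).Nonempty :=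
    ((Set.Ioo_infinite h).sdiff (Set.finite_range A.x)).nonempty
  obtain ⟨ξ, h1, h2⟩ := h1
  exact ⟨ξ, h1.1, h1.2, fun p hp => h2 ⟨p, hp⟩⟩

theorem exists_near_right [Finite P] (v : P) : ∃ ξ, A.x v < ξ ∧ A.Near v ξ := by
  have h : ∀ᶠ ξ in nhdsWithin (A.x v) (Set.Ioi (A.x v)), ∀ p, p ≠ v →
      (A.x p < A.x v ∧ A.x p < ξ) ∨ (A.x v < A.x p ∧ ξ < A.x p) := by
    rw [Filter.eventually_all]
    intro p
    by_cases hp : p = v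
    · simp [hp]
    rcases lt_or_gt_of_ne (A.x_ne hp) with h | h
    · filter_upwards [self_mem_nhdsWithin] with ξ hξ _
      exact Or.inl ⟨h, h.trans hξ⟩
    · filter_upwards [Ioo_mem_nhdsGT h] with ξ hξ _
      exact Or.inr ⟨h, hξ.2⟩
  obtain ⟨ξ, h1, h2⟩ := (h.and self_mem_nhdsWithin).exists
  exact ⟨ξ, h2, (ne_of_gt h2), h1⟩

theorem exists_near_left [Finite P] (v : P) : ∃ ξ, ξ < A.x v ∧ A.Near v ξ := by
  have h : ∀ᶠ ξ in nhdsWithin (A.x v) (Set.Iio (A.x v)), ∀ p, p ≠ v →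
      (A.x p < A.x v ∧ A.x p < ξ) ∨ (A.x v < A.x p ∧ ξ < A.x p) := by
    rw [Filter.eventually_all]
    intro p
    by_cases hp : p = v
    · simp [hp]
    rcases lt_or_gt_of_ne (A.x_ne hp) with h | h
    · filter_upwards [Ioo_mem_nhdsLT h] with ξ hξ _
      exact Or.inl ⟨h, hξ.1⟩
    · filter_upwards [self_mem_nhdsWithin] with ξ hξ _
      exact Or.inr ⟨h, lt_trans hξ h⟩
  obtain ⟨ξ, h1, h2⟩ := (h.and self_mem_nhdsWithin).exists
  exact ⟨ξ, h2, (ne_of_lt h2), h1⟩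

/-- An abscissa strictly between the ends of `s` that is not the abscissa of a point. -/
noncomputable def mid [Finite P] (s : S) : ℝ := (A.exists_between_ne (A.x_lt s)).choose

theorem over_mid [Finite P] (s : S) : A.Over s (A.mid s) :=
  ⟨(A.exists_between_ne (A.x_lt s)).choose_spec.1, (A.exists_between_ne (A.x_lt s)).choose_spec.2.1⟩

theorem x_ne_mid [Finite P] (s : S) (p : P) : A.x p ≠ A.mid s :=
  (A.exists_between_ne (A.x_lt s)).choose_spec.2.2 p

/-! ### Faces and the cycle space mod 2 -/

section Cycles

variable [Fintype S]

open Classical in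
/-- The boundary of a mod 2 chain of arcs. -/
noncomputable def boundary : (S → ZMod 2) →ₗ[ZMod 2] (P → ZMod 2) :=
  Matrix.mulVecLin (Matrix.of fun p s =>
    (if A.l s = p then 1 else 0) + (if A.r s = p then 1 else 0))

open Classical in
theorem boundary_apply (C : S → ZMod 2) (p : P) : A.boundary C p =
    ∑ s, ((if A.l s = p then 1 else 0) + (if A.r s = p then 1 else 0)) * C s := rfl

open Classical in
/-- The parity of the number of arcs of `C` above the point `(ξ, η)`. -/
noncomputable def above (ξ η : ℝ) (C : S → ZMod 2) : ZMod 2 :=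
  ∑ t, if A.Over t ξ ∧ η < A.h t ξ then C t else 0

open Classical in
-- Pairs the boundary of `C`, which is zero, with the indicator of `Q`.
theorem sum_boundary_eq_zero [Fintype P] {C : S → ZMod 2} (hC : A.boundary C = 0) (Q : P → Prop) :
    ∑ t, ((if Q (A.l t) then 1 else 0) + (if Q (A.r t) then 1 else 0)) * C t = 0 := by
  have h : ∑ p, (if Q p then A.boundary C p else 0) = 0 := by simp [hC]
  refine Eq.trans ?_ h
  simp only [boundary_apply, Finset.ite_sum_zero]
  rw [Finset.sum_comm]
  refine Finset.sum_congr rfl fun t _ => ?_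
  have h1 : ∀ p, (if Q p then ((if A.l t = p then 1 else 0) + (if A.r t = p then 1 else 0)) * C t
      else 0) = (if A.l t = p then (if Q p then C t else 0) else 0) +
        (if A.r t = p then (if Q p then C t else 0) else 0) := by
    intro p
    split_ifs <;> ring
  simp only [h1, Finset.sum_add_distrib, Finset.sum_ite_eq, Finset.mem_univ, if_true]
  split_ifs <;> ring

/-- The parity changes by the number of ends of arcs of `C` above `s` in the strip, which is even
for a cycle. -/
theorem above_eq_above_of_lt [Fintype P] {C : S → ZMod 2} (hC : A.boundary C = 0) {s : S} {ξ ξ' : ℝ}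
    (hlt : ξ < ξ') (hs : A.Over s ξ) (hs' : A.Over s ξ')
    (hξ : ∀ p, A.x p ≠ ξ) (hξ' : ∀ p, A.x p ≠ ξ') :
    A.above ξ (A.h s ξ) C = A.above ξ' (A.h s ξ') C := by
  classical
  rw [← sub_eq_zero, CharTwo.sub_eq_add, ← A.sum_boundary_eq_zero hC (A.Between s ξ ξ')]
  unfold above
  rw [← Finset.sum_add_distrib]
  refine Finset.sum_congr rfl fun t _ => ?_
  by_cases hst : s = t
  · subst hst
    have h1 := hs.1
    have h2 := hs'.2
    simp [Between, not_lt.2 h1.le, not_lt.2 h2.le]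
  · rw [← A.above_add_above hst hlt hs hs' hξ hξ', add_mul, ite_mul, ite_mul]
    simp

theorem above_eq_above [Fintype P] {C : S → ZMod 2} (hC : A.boundary C = 0) {s : S} {ξ ξ' : ℝ}
    (hs : A.Over s ξ) (hs' : A.Over s ξ') (hξ : ∀ p, A.x p ≠ ξ) (hξ' : ∀ p, A.x p ≠ ξ') :
    A.above ξ (A.h s ξ) C = A.above ξ' (A.h s ξ') C := by
  rcases lt_trichotomy ξ ξ' with h | h | h
  · exact A.above_eq_above_of_lt hC h hs hs' hξ hξ'
  · rw [h]
  · exact (A.above_eq_above_of_lt hC h hs' hs hξ' hξ).symm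

open Classical in
-- Arcs that miss `v` keep their position relative to `s` between `v` and `ξ`. Arcs at `v` are not
-- counted at `v` itself, since `Over` is strict.
theorem above_near {v : P} {ξ : ℝ} (hξ : A.Near v ξ) (C : S → ZMod 2) {s : S}
    (hs : A.Over s ξ) (hv : A.l s = v ∨ A.r s = v) :
    A.above ξ (A.h s ξ) C = A.above (A.x v) (A.y v) C +
      ∑ t with (A.Over t ξ ∧ (A.l t = v ∨ A.r t = v)) ∧ A.h s ξ < A.h t ξ, C t := by
  unfold above
  rw [Finset.sum_filter, ← Finset.sum_add_distrib]
  refine Finset.sum_congr rfl fun t _ => ?_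
  by_cases htv : A.l t = v ∨ A.r t = v
  · have : ¬ A.Over t (A.x v) := by
      rintro ⟨h1, h2⟩
      rcases htv with h | h
      · rw [h] at h1; exact lt_irrefl _ h1
      · rw [h] at h2; exact lt_irrefl _ h2
    simp [htv, this]
  · have hl : A.l t ≠ v := fun h => htv (Or.inl h)
    have hr : A.r t ≠ v := fun h => htv (Or.inr h)
    have hO : A.Over t ξ ↔ A.Over t (A.x v) := by
      unfold Over
      have h1 := hξ.2 _ hl
      have h2 := hξ.2 _ hr
      constructor
      · rintro ⟨h3, h4⟩
        rcases h1 with h1 | h1 <;> rcases h2 with h2 | h2 <;> constructor <;> linarith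
      · rintro ⟨h3, h4⟩
        rcases h1 with h1 | h1 <;> rcases h2 with h2 | h2 <;> constructor <;> linarith
    simp only [htv, and_false, false_and, if_false, add_zero, hO]
    by_cases hO' : A.Over t (A.x v)
    · have hts : t ≠ s := by
        rintro rfl; exact htv hv
      have hO'' := hO.2 hO'
      have hsv : A.h s (A.x v) = A.y v := by
        rcases hv with h | h
        · rw [← h, A.h_left]
        · rw [← h, A.h_right]
      have hsW : A.WeakOver s (A.x v) := by
        have := A.x_lt s
        rcases hv with h | h
        · exact ⟨by rw [h], by rw [← h]; exact this.le⟩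
        · exact ⟨by rw [← h]; exact this.le, by rw [h]⟩
      have : A.h s ξ < A.h t ξ ↔ A.h s (A.x v) < A.h t (A.x v) := by
        apply lt_iff_lt_of_ne_on (A.continuous_h s) (A.continuous_h t)
        intro ζ hζ
        refine (A.h_ne hts ?_ ?_).symm
        · rcases Set.mem_uIcc.1 hζ with h | h
          · exact ⟨hO''.1.trans_le h.1, h.2.trans_lt hO'.2⟩
          · exact ⟨hO'.1.trans_le h.1, h.2.trans_lt hO''.2⟩
        · rcases Set.mem_uIcc.1 hζ with h | h
          · exact ⟨hs.1.le.trans h.1, h.2.trans hsW.2⟩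
          · exact ⟨hsW.1.trans h.1, h.2.trans hs.2.le⟩
      simp only [this, hsv]
    · simp [hO']

variable [Finite P]

/-- The cycle space. -/
noncomputable abbrev cycles : Submodule (ZMod 2) (S → ZMod 2) := LinearMap.ker A.boundary

/-- The face on the upper side of `s`, represented by the parity with which the cycles enclose it. -/
noncomputable def upper (s : S) : A.cycles → ZMod 2 :=
  fun C => A.above (A.mid s) (A.h s (A.mid s)) C.1

/-- The face on the lower side of `s`. -/
noncomputable def lower (s : S) : A.cycles → ZMod 2 := A.upper s + fun C => C.1 s

open Classical in
/-- The boundary of the face `φ`. -/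
noncomputable def faceBoundary (φ : A.cycles → ZMod 2) (s : S) : ZMod 2 :=
  (if A.upper s = φ then 1 else 0) + (if A.lower s = φ then 1 else 0)

open Classical in
-- The upper sides of these arcs are partial sums starting from the value at `v`, and each lower
-- side adds one more term, so the sum telescopes.
theorem sum_faceBoundary_near (φ : A.cycles → ZMod 2) {v : P} {ξ : ℝ} (hξ : A.Near v ξ) :
    ∑ s with A.Over s ξ ∧ (A.l s = v ∨ A.r s = v), A.faceBoundary φ s =
      (if (fun C : A.cycles => A.above (A.x v) (A.y v) C.1) = φ then 1 else 0) +
      (if (fun C : A.cycles => A.above (A.x v) (A.y v) C.1) +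
        ∑ s with A.Over s ξ ∧ (A.l s = v ∨ A.r s = v), (fun C : A.cycles => C.1 s) = φ
          then 1 else 0) := by
  have := Fintype.ofFinite P
  rw [← Finset.sum_indicator_partial_sums (fun s => A.h s ξ)]
  · refine Finset.sum_congr rfl fun s hs => ?_
    simp only [Finset.mem_filter, Finset.mem_univ, true_and] at hs
    have hu : A.upper s = (fun C : A.cycles => A.above (A.x v) (A.y v) C.1) +
        ∑ t ∈ Finset.univ.filter (fun t => A.Over t ξ ∧ (A.l t = v ∨ A.r t = v)) with
          A.h s ξ < A.h t ξ, (fun C : A.cycles => C.1 t) := by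
      funext C
      rw [Pi.add_apply, Finset.sum_apply, Finset.filter_filter]
      rw [← A.above_near hξ C.1 hs.1 hs.2]
      exact A.above_eq_above C.2 (A.over_mid s) hs.1 (A.x_ne_mid s) hξ.ne
    unfold faceBoundary lower
    rw [hu]
  · intro s hs t ht hst
    simp only [Finset.coe_filter, Finset.mem_univ, true_and, Set.mem_ofPred_eq] at hs ht
    by_contra hne
    exact A.h_ne hne hs.1 ht.1.weak hst

/-- The scans to the right and to the left of `v` start from the same value, and end at the same
value because a cycle has equally many arcs mod 2 on both sides of `v`. So the two sums cancel. -/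
theorem boundary_faceBoundary (φ : A.cycles → ZMod 2) : A.boundary (A.faceBoundary φ) = 0 := by
  classical
  have := Fintype.ofFinite P
  funext v
  obtain ⟨ξ, h1, hξ⟩ := A.exists_near_right v
  obtain ⟨ζ, h2, hζ⟩ := A.exists_near_left v
  have hR : ∀ s, (A.Over s ξ ∧ (A.l s = v ∨ A.r s = v)) ↔ A.l s = v := by
    intro s
    constructor
    · rintro ⟨h3, h4 | h4⟩
      · exact h4
      · have := h3.2; rw [h4] at this; linarith
    · intro h
      have hr : A.r s ≠ v := by
        intro h'; have := A.x_lt s; rw [h, h'] at this; exact lt_irrefl _ this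
      refine ⟨⟨by rw [h]; exact h1, ?_⟩, Or.inl h⟩
      have := A.x_lt s
      rw [h] at this
      rcases hξ.2 _ hr with h' | h' <;> linarith
  have hL : ∀ s, (A.Over s ζ ∧ (A.l s = v ∨ A.r s = v)) ↔ A.r s = v := by
    intro s
    constructor
    · rintro ⟨h3, h4 | h4⟩
      · have := h3.1; rw [h4] at this; linarith
      · exact h4
    · intro h
      have hr : A.l s ≠ v := by
        intro h'; have := A.x_lt s; rw [h, h'] at this; exact lt_irrefl _ this
      refine ⟨⟨?_, by rw [h]; exact h2⟩, Or.inr h⟩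
      have := A.x_lt s
      rw [h] at this
      rcases hζ.2 _ hr with h' | h' <;> linarith
  have e1 := A.sum_faceBoundary_near φ hξ
  have e2 := A.sum_faceBoundary_near φ hζ
  simp only [hR] at e1
  simp only [hL] at e2
  have e3 : (∑ s with A.l s = v, (fun C : A.cycles => C.1 s)) =
      ∑ s with A.r s = v, (fun C : A.cycles => C.1 s) := by
    funext C
    have hC : A.boundary C.1 v = 0 := congrFun C.2 v
    rw [A.boundary_apply] at hC
    simp only [add_mul, ite_mul, one_mul, zero_mul, Finset.sum_add_distrib,
      ← Finset.sum_filter] at hC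
    rw [← CharTwo.sub_eq_add, sub_eq_zero] at hC
    rw [Finset.sum_apply, Finset.sum_apply]
    exact hC
  rw [A.boundary_apply]
  simp only [add_mul, ite_mul, one_mul, zero_mul, Finset.sum_add_distrib, ← Finset.sum_filter]
  rw [e1, e2, e3, CharTwo.add_self_eq_zero]
  rfl

open Classical in
/-- The faces that lie on a side of an arc. -/
noncomputable def faces : Finset (A.cycles → ZMod 2) :=
  Finset.univ.image A.upper ∪ Finset.univ.image A.lower

/-- At `s` only the faces on its two sides matter, and their values on `C` differ by `C s`. -/
theorem sum_faces (C : A.cycles) : ∑ φ ∈ A.faces, φ C • A.faceBoundary φ = C.1 := by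
  classical
  funext s
  have hu : A.upper s ∈ A.faces := by simp [faces]
  have hl : A.lower s ∈ A.faces := by simp [faces]
  simp only [Finset.sum_apply, Pi.smul_apply, faceBoundary, smul_eq_mul, mul_add, mul_ite, mul_one,
    mul_zero, Finset.sum_add_distrib, Finset.sum_ite_eq, hu, hl, if_true]
  simp only [lower, Pi.add_apply]
  rw [← add_assoc, CharTwo.add_self_eq_zero, zero_add]

/-- The cycle space has a basis in which every arc occurs at most twice. -/
theorem exists_two_basis [Fintype P] : ∃ B : Finset (S → ZMod 2),
    (∀ b ∈ B, b ≠ 0 ∧ A.boundary b = 0) ∧ Fintype.card S ≤ Fintype.card P + B.card ∧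
      ∀ s, ({b ∈ B | b s ≠ 0}).card ≤ 2 := by
  classical
  have hspan : Submodule.span (ZMod 2) (A.faceBoundary '' (A.faces : Set _)) = A.cycles := by
    apply le_antisymm
    · rw [Submodule.span_le]
      rintro _ ⟨φ, -, rfl⟩
      exact A.boundary_faceBoundary φ
    · intro C hC
      have := A.sum_faces ⟨C, hC⟩
      simp only at this
      rw [← this]
      exact Submodule.sum_mem _ fun φ hφ => Submodule.smul_mem _ _
        (Submodule.subset_span ⟨φ, hφ, rfl⟩)
  obtain ⟨B, hB, hBspan, hli⟩ := exists_linearIndependent (ZMod 2)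
    (A.faceBoundary '' (A.faces : Set _))
  have hfin : B.Finite := (A.faces.finite_toSet.image _).subset hB
  lift B to Finset (S → ZMod 2) using hfin
  refine ⟨B, ?_, ?_, ?_⟩
  · intro b hb
    refine ⟨hli.ne_zero ⟨b, hb⟩, ?_⟩
    obtain ⟨φ, -, rfl⟩ := hB hb
    exact A.boundary_faceBoundary φ
  · have h1 : Module.finrank (ZMod 2) A.cycles = B.card := by
      rw [← hspan, ← hBspan, finrank_span_set_eq_card hli]
      simp
    have h2 := LinearMap.finrank_range_add_finrank_ker A.boundary
    -- This crude bound on the rank suffices because the discharging ends in a strict inequality.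
    have h3 := Submodule.finrank_le (LinearMap.range A.boundary)
    rw [Module.finrank_fintype_fun_eq_card] at h2 h3
    change _ + Module.finrank (ZMod 2) A.cycles = _ at h2
    omega
  · intro s
    have hsub : {b ∈ B | b s ≠ 0} ⊆ {A.faceBoundary (A.upper s), A.faceBoundary (A.lower s)} := by
      intro b hb
      rw [Finset.mem_filter] at hb
      obtain ⟨φ, -, rfl⟩ := hB hb.1
      rw [Finset.mem_insert, Finset.mem_singleton]
      by_cases h1 : A.upper s = φ
      · left; rw [h1]
      by_cases h2 : A.lower s = φ
      · right; rw [h2]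
      exact absurd (by simp [faceBoundary, h1, h2]) hb.2
    exact (Finset.card_le_card hsub).trans Finset.card_le_two

end Cycles

end MonotoneArcs

/-! ### Straight line graphs -/

theorem exists_shear {P : Type*} [Finite P] {pos : P → ℝ × ℝ} (hpos : Function.Injective pos) :
    ∃ ε : ℝ, Function.Injective fun p => (pos p).1 + ε * (pos p).2 := by
  -- Two points at different heights get equal abscissas for only one `ε`; all such values are
  -- avoided.
  have hfin : (Set.range fun pq : P × P =>
      ((pos pq.1).1 - (pos pq.2).1) / ((pos pq.2).2 - (pos pq.1).2)).Finite := Set.finite_range _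
  obtain ⟨ε, hε⟩ := hfin.infinite_compl.nonempty
  refine ⟨ε, fun p q hpq => ?_⟩
  simp only at hpq
  by_cases h : (pos p).2 = (pos q).2
  · rw [h] at hpq
    exact hpos (Prod.ext (by linarith) h)
  · refine absurd ⟨(p, q), ?_⟩ hε
    have : (pos q).2 - (pos p).2 ≠ 0 := fun h' => h (by linarith)
    simp only
    rw [div_eq_iff this]
    linarith

/-- The cycle space of a plane straight line graph has a basis in which every segment occurs at most
twice. -/
theorem exists_two_basis_of_segments {P S : Type*} [Fintype P] [Fintype S] [DecidableEq P]
    {pos : P → ℝ × ℝ}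
    (hpos : Function.Injective pos) (a b : S → P) (hab : ∀ s, a s ≠ b s)
    (inter : ∀ s t, s ≠ t → ∀ z, z ∈ segment ℝ (pos (a s)) (pos (b s)) →
      z ∈ segment ℝ (pos (a t)) (pos (b t)) →
      ∃ p, (p = a s ∨ p = b s) ∧ (p = a t ∨ p = b t) ∧ z = pos p) :
    ∃ B : Finset (S → ZMod 2),
      (∀ C ∈ B, C ≠ 0 ∧
        ∀ p, ∑ s, ((if a s = p then 1 else 0) + (if b s = p then 1 else 0)) * C s = 0) ∧
      Fintype.card S ≤ Fintype.card P + B.card ∧ ∀ s, ({C ∈ B | C s ≠ 0}).card ≤ 2 := by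
  classical
  obtain ⟨ε, hε⟩ := exists_shear hpos
  set x : P → ℝ := fun p => (pos p).1 + ε * (pos p).2 with hx
  set l : S → P := fun s => if x (a s) < x (b s) then a s else b s with hl
  set r : S → P := fun s => if x (a s) < x (b s) then b s else a s with hr
  have hlr : ∀ s, (l s = a s ∧ r s = b s) ∨ (l s = b s ∧ r s = a s) := by
    intro s
    by_cases h : x (a s) < x (b s)
    · left; simp [hl, hr, h]
    · right; simp [hl, hr, h]
  have hlt : ∀ s, x (l s) < x (r s) := by
    intro s
    by_cases h : x (a s) < x (b s)
    · simp only [hl, hr, h, if_true]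
    · simp only [hl, hr, h, if_false]
      exact lt_of_le_of_ne (not_lt.1 h) fun h' => hab s (hε h').symm
  have hseg : ∀ s, segment ℝ (pos (l s)) (pos (r s)) = segment ℝ (pos (a s)) (pos (b s)) := by
    intro s
    rcases hlr s with ⟨h1, h2⟩ | ⟨h1, h2⟩
    · rw [h1, h2]
    · rw [h1, h2, segment_symm]
  let h : S → ℝ → ℝ := fun s ξ =>
    (pos (l s)).2 + (ξ - x (l s)) / (x (r s) - x (l s)) * ((pos (r s)).2 - (pos (l s)).2)
  -- The inverse shear `(ξ, η) ↦ (ξ - ε η, η)` takes the graph of `h s` back to the segment.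
  have hmem : ∀ s ξ, x (l s) ≤ ξ → ξ ≤ x (r s) →
      (ξ - ε * h s ξ, h s ξ) ∈ segment ℝ (pos (a s)) (pos (b s)) := by
    intro s ξ h1 h2
    have hd := sub_pos.2 (hlt s)
    rw [← hseg, segment_eq_image']
    refine ⟨(ξ - x (l s)) / (x (r s) - x (l s)),
      ⟨div_nonneg (by linarith) hd.le, (div_le_one hd).2 (by linarith)⟩, ?_⟩
    ext
    · simp only [h, Prod.fst_add, Prod.smul_fst, Prod.fst_sub, smul_eq_mul]
      have e1 : (ξ - x (l s)) / (x (r s) - x (l s)) * (x (r s) - x (l s)) = ξ - x (l s) :=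
        div_mul_cancel₀ _ hd.ne'
      generalize (ξ - x (l s)) / (x (r s) - x (l s)) = τ at *
      simp only [hx] at e1
      linear_combination e1
    · simp only [h, Prod.snd_add, Prod.smul_snd, Prod.snd_sub, smul_eq_mul]
  let A : MonotoneArcs P S :=
    { x := x
      y := fun p => (pos p).2
      l := l
      r := r
      h := h
      x_injective := hε
      x_lt := hlt
      continuous_h := fun s => by
        simp only [h]
        fun_prop
      h_left := fun s => by simp [h]
      h_right := fun s => by
        have := (sub_pos.2 (hlt s)).ne'
        simp only [h, div_self this]
        ring
      inter := by
        intro s t hst ξ h1 h2 h3 h4 h5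
        have m1 := hmem s ξ h1 h2
        have m2 := hmem t ξ h3 h4
        rw [← h5] at m2
        obtain ⟨p, hp1, hp2, hp3⟩ := inter s t hst _ m1 m2
        refine ⟨p, ?_, ?_, ?_⟩
        · rcases hlr s with ⟨e1, e2⟩ | ⟨e1, e2⟩ <;> rw [e1, e2] <;> tauto
        · rcases hlr t with ⟨e1, e2⟩ | ⟨e1, e2⟩ <;> rw [e1, e2] <;> tauto
        · simp only [hx, ← hp3]
          ring }
  obtain ⟨B, hB, hcard, htwo⟩ := A.exists_two_basis
  refine ⟨B, fun C hC => ⟨(hB C hC).1, fun p => ?_⟩, hcard, htwo⟩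
  have := congrFun (hB C hC).2 p
  rw [A.boundary_apply] at this
  refine Eq.trans (Finset.sum_congr rfl fun s _ => ?_) this
  congr 1
  have h1 : A.l s = l s := rfl
  have h2 : A.r s = r s := rfl
  rw [h1, h2]
  rcases hlr s with ⟨e1, e2⟩ | ⟨e1, e2⟩
  · rw [e1, e2]; congr!
  · rw [e1, e2, add_comm]; congr!

/-! ### Polygonal edges -/

/-- A plane drawing with edges indexed by `E`, the edge `e` being the polygonal line with the nodes
`x e 0, …, x e (n e)`. -/
structure PolylineDrawing (V E : Type*) where
  point : V → ℝ × ℝ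
  u : E → V
  v : E → V
  n : E → ℕ
  x : E → ℕ → ℝ × ℝ
  point_injective : Function.Injective point
  n_pos : ∀ e, 1 ≤ n e
  x_zero : ∀ e, x e 0 = point (u e)
  x_last : ∀ e, x e (n e) = point (v e)
  x_ne : ∀ e i, i < n e → x e i ≠ x e (i + 1)
  self_inter : ∀ e i j, i < j → j < n e → ∀ y, y ∈ segment ℝ (x e i) (x e (i + 1)) →
    y ∈ segment ℝ (x e j) (x e (j + 1)) → j = i + 1 ∧ y = x e j
  vertex_mem : ∀ e i w, i < n e → point w ∈ segment ℝ (x e i) (x e (i + 1)) → w = u e ∨ w = v e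
  inter : ∀ e f, e ≠ f → ∀ i j, i < n e → j < n f → ∀ y, y ∈ segment ℝ (x e i) (x e (i + 1)) →
    y ∈ segment ℝ (x f j) (x f (j + 1)) →
      ∃ w, (w = u e ∨ w = v e) ∧ (w = u f ∨ w = v f) ∧ y = point w

namespace PolylineDrawing

variable {V E : Type*} (D : PolylineDrawing V E)

theorem x_ne_of_lt (e : E) {i j : ℕ} (hij : i < j) (hj : j ≤ D.n e) : D.x e i ≠ D.x e j := by
  intro h
  rcases Nat.lt_or_ge (i + 1) j with h1 | h1
  · rcases Nat.lt_or_ge j (D.n e) with h2 | h2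
    · have := D.self_inter e i j hij h2 (D.x e i) (left_mem_segment _ _ _)
        (h ▸ left_mem_segment _ _ _)
      omega
    · obtain ⟨k, rfl⟩ : ∃ k, j = k + 1 := ⟨j - 1, by omega⟩
      obtain ⟨h3, h4⟩ := D.self_inter e i k (by omega) (by omega) (D.x e i)
        (left_mem_segment _ _ _) (h ▸ right_mem_segment _ _ _)
      exact D.x_ne e k (by omega) (h4.symm.trans h)
  · obtain rfl : j = i + 1 := by omega
    exact D.x_ne e i (by omega) h

theorem x_injOn (e : E) {i j : ℕ} (hi : i ≤ D.n e) (hj : j ≤ D.n e) (h : D.x e i = D.x e j) :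
    i = j := by
  rcases lt_trichotomy i j with h1 | h1 | h1
  · exact absurd h (D.x_ne_of_lt e h1 hj)
  · exact h1
  · exact absurd h.symm (D.x_ne_of_lt e h1 hi)

/-- The vertices and the bends of the edges. -/
abbrev Node : Type _ := V ⊕ Σ e : E, Fin (D.n e - 1)

/-- The line segments that make up the edges. -/
abbrev Segment : Type _ := Σ e : E, Fin (D.n e)

/-- The position of a node in the plane. -/
def pos : D.Node → ℝ × ℝ
  | Sum.inl w => D.point w
  | Sum.inr q => D.x q.1 (q.2 + 1)

/-- The `i`-th node of the edge `e`. -/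
def node (e : E) (i : ℕ) : D.Node :=
  if i = 0 then Sum.inl (D.u e) else
    if h : i - 1 < D.n e - 1 then Sum.inr ⟨e, i - 1, h⟩ else Sum.inl (D.v e)

theorem node_zero (e : E) : D.node e 0 = Sum.inl (D.u e) := by simp [node]

theorem node_last (e : E) : D.node e (D.n e) = Sum.inl (D.v e) := by
  have := D.n_pos e
  simp [node, show D.n e ≠ 0 by omega]

theorem pos_node (e : E) {i : ℕ} (hi : i ≤ D.n e) : D.pos (D.node e i) = D.x e i := by
  unfold node
  split_ifs with h1 h2
  · rw [h1, D.x_zero]; rfl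
  · simp only [pos]
    congr 1
    omega
  · obtain rfl : i = D.n e := by omega
    rw [D.x_last]; rfl

theorem node_eq_inr_iff {e f : E} {i : ℕ} {k : Fin (D.n f - 1)} :
    D.node e i = Sum.inr ⟨f, k⟩ ↔ e = f ∧ i = k + 1 := by
  constructor
  · intro h
    unfold node at h
    split_ifs at h with h1 h2
    obtain ⟨rfl, h3⟩ := Sigma.mk.inj (Sum.inr_injective h)
    have := congrArg Fin.val (eq_of_heq h3)
    simp only at this
    exact ⟨rfl, by omega⟩
  · rintro ⟨rfl, rfl⟩
    have := k.2
    simp [node, this]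

theorem x_eq_point (e : E) {w : V} (hw : w = D.u e ∨ w = D.v e) {i : ℕ} (hi : i ≤ D.n e)
    (h : D.x e i = D.point w) : i = 0 ∨ i = D.n e := by
  rcases hw with rfl | rfl
  · rw [← D.x_zero] at h
    exact Or.inl (D.x_injOn e hi (Nat.zero_le _) h)
  · rw [← D.x_last] at h
    exact Or.inr (D.x_injOn e hi le_rfl h)

theorem pos_injective : Function.Injective D.pos := by
  -- A bend is never a vertex: a polygonal line meets its ends only as first or last node.
  have key : ∀ w e (k : Fin (D.n e - 1)), D.point w ≠ D.x e (k + 1) := by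
    intro w e k h
    have hk := k.2
    have h1 : D.point w ∈ segment ℝ (D.x e (k + 1)) (D.x e (k + 1 + 1)) :=
      h ▸ left_mem_segment _ _ _
    rcases D.x_eq_point e (D.vertex_mem e _ w (by omega) h1) (by omega) h.symm with h2 | h2 <;> omega
  rintro (w | ⟨e, k⟩) (w' | ⟨f, j⟩) h
  · exact congrArg _ (D.point_injective h)
  · exact absurd h (key _ _ _)
  · exact absurd h.symm (key _ _ _)
  · simp only [pos] at h
    have hk := k.2
    have hj := j.2
    by_cases hef : e = f
    · subst hef
      have : k = j := Fin.ext (by have := D.x_injOn e (by omega) (by omega) h; omega)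
      rw [this]
    · obtain ⟨w, -, -, hw⟩ := D.inter e f hef (k + 1) (j + 1) (by omega) (by omega) _
        (left_mem_segment _ _ _) (h ▸ left_mem_segment _ _ _)
      exact absurd hw.symm (key _ _ _)

theorem node_eq_of_point_mem (e : E) {w : V} (hw : w = D.u e ∨ w = D.v e) {i : ℕ} (hi : i < D.n e)
    (h : D.point w ∈ segment ℝ (D.x e i) (D.x e (i + 1))) :
    Sum.inl w = D.node e i ∨ Sum.inl w = D.node e (i + 1) := by
  rcases hw with rfl | rfl
  · left
    rcases Nat.eq_zero_or_pos i with rfl | h0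
    · exact (D.node_zero e).symm
    · rw [← D.x_zero] at h
      obtain ⟨h1, h2⟩ := D.self_inter e 0 i h0 hi _ (left_mem_segment _ _ _) h
      exact absurd h2 (D.x_ne_of_lt e h0 hi.le)
  · right
    rcases Nat.lt_or_ge (i + 1) (D.n e) with h0 | h0
    · rw [← D.x_last] at h
      obtain ⟨m, hm⟩ : ∃ m, D.n e = m + 1 := ⟨D.n e - 1, by omega⟩
      rw [hm] at h
      obtain ⟨h1, h2⟩ := D.self_inter e i m (by omega) (by omega) _ h (right_mem_segment _ _ _)
      exact absurd h2.symm (D.x_ne e m (by omega))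
    · rw [show i + 1 = D.n e by omega, D.node_last]

/-- The cycle space of a plane graph has a basis in which every edge occurs at most twice. -/
theorem exists_two_basis [Fintype V] [Fintype E] [DecidableEq V] : ∃ B : Finset (E → ZMod 2),
    (∀ C ∈ B, C ≠ 0 ∧
      ∀ w, ∑ e, ((if D.u e = w then 1 else 0) + (if D.v e = w then 1 else 0)) * C e = 0) ∧
    Fintype.card E ≤ Fintype.card V + B.card ∧ ∀ e, ({C ∈ B | C e ≠ 0}).card ≤ 2 := by
  classical
  have hseg : ∀ s : D.Segment, segment ℝ (D.pos (D.node s.1 s.2)) (D.pos (D.node s.1 (s.2 + 1))) =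
      segment ℝ (D.x s.1 s.2) (D.x s.1 (s.2 + 1)) := by
    intro s
    have := s.2.2
    rw [D.pos_node _ (by omega), D.pos_node _ (by omega)]
  obtain ⟨B, hB, hcard, htwo⟩ := exists_two_basis_of_segments D.pos_injective
    (fun s : D.Segment => D.node s.1 s.2) (fun s => D.node s.1 (s.2 + 1)) (by
      intro s h
      have h2 := s.2.2
      have := congrArg D.pos h
      rw [D.pos_node _ (by omega), D.pos_node _ (by omega)] at this
      exact D.x_ne _ _ h2 this) (by
      rintro ⟨e, i⟩ ⟨f, j⟩ hst z hz1 hz2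
      rw [hseg] at hz1 hz2
      simp only at hz1 hz2 ⊢
      have hi := i.2
      have hj := j.2
      by_cases hef : e = f
      · subst hef
        have hij : (i : ℕ) ≠ j := fun h => hst (by rw [Fin.ext h])
        rcases lt_or_gt_of_ne hij with h | h
        · obtain ⟨h1, h2⟩ := D.self_inter e i j h hj z hz1 hz2
          exact ⟨D.node e j, Or.inr (by rw [h1]), Or.inl rfl, by rw [D.pos_node _ (by omega), h2]⟩
        · obtain ⟨h1, h2⟩ := D.self_inter e j i h hi z hz2 hz1
          exact ⟨D.node e i, Or.inl rfl, Or.inr (by rw [h1]), by rw [D.pos_node _ (by omega), h2]⟩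
      · obtain ⟨w, h1, h2, rfl⟩ := D.inter e f hef i j hi hj z hz1 hz2
        exact ⟨Sum.inl w, D.node_eq_of_point_mem e h1 hi hz1, D.node_eq_of_point_mem f h2 hj hz2,
          rfl⟩)
  -- Just two segments meet at a bend, so a cycle takes the same value on both.
  have hconst : ∀ C ∈ B, ∀ e i (hi : i < D.n e), C ⟨e, i, hi⟩ = C ⟨e, 0, D.n_pos e⟩ := by
    intro C hC e i
    induction i with
    | zero => intro _; rfl
    | succ i ih =>
      intro hi
      rw [← ih (by omega)]
      have h1 := (hB C hC).2 (Sum.inr ⟨e, i, by omega⟩)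
      have h2 : ∀ s : D.Segment, D.node s.1 s.2 = Sum.inr ⟨e, i, by omega⟩ ↔ s = ⟨e, i + 1, hi⟩ := by
        rintro ⟨f, j⟩
        rw [node_eq_inr_iff]
        constructor
        · rintro ⟨rfl, h⟩
          congr 1
          exact Fin.ext h
        · intro h
          cases h
          exact ⟨rfl, rfl⟩
      have h3 : ∀ s : D.Segment,
          D.node s.1 (s.2 + 1) = Sum.inr ⟨e, i, by omega⟩ ↔ s = ⟨e, i, by omega⟩ := by
        rintro ⟨f, j⟩
        rw [node_eq_inr_iff]
        constructor
        · rintro ⟨rfl, h⟩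
          congr 1
          exact Fin.ext (Nat.succ_injective h)
        · intro h
          cases h
          exact ⟨rfl, rfl⟩
      simp only [h2, h3, add_mul, ite_mul, one_mul, zero_mul, Finset.sum_add_distrib,
        Finset.sum_ite_eq', Finset.mem_univ, if_true] at h1
      rwa [← CharTwo.sub_eq_add, sub_eq_zero] at h1
  let ρ : (D.Segment → ZMod 2) → E → ZMod 2 := fun C e => C ⟨e, 0, D.n_pos e⟩
  have hinj : Set.InjOn ρ B := by
    intro C hC C' hC' h
    funext s
    rw [hconst C hC, hconst C' hC']
    exact congrFun h s.1
  refine ⟨B.image ρ, ?_, ?_, ?_⟩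
  · intro C' hC'
    obtain ⟨C, hC, rfl⟩ := Finset.mem_image.1 hC'
    constructor
    · intro h
      refine (hB C hC).1 (funext fun s => ?_)
      rw [hconst C hC]
      exact congrFun h s.1
    · intro w
      have h1 := (hB C hC).2 (Sum.inl w)
      rw [Fintype.sum_sigma] at h1
      refine Eq.trans (Finset.sum_congr rfl fun e _ => ?_) h1
      simp only [fun i : Fin (D.n e) => hconst C hC e i.1 i.2]
      rw [← Finset.sum_mul]
      congr 1
      let g : ℕ → ZMod 2 := fun i => if D.node e i = Sum.inl w then 1 else 0
      have h2 : ∑ i : Fin (D.n e), (g i + g (i + 1)) = g 0 + g (D.n e) := by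
        rw [Fin.sum_univ_eq_sum_range (fun i => g i + g (i + 1))]
        have := Finset.sum_range_sub g (D.n e)
        simp only [CharTwo.sub_eq_add] at this
        rw [add_comm (g 0), ← this]
        exact Finset.sum_congr rfl fun i _ => add_comm _ _
      rw [h2]
      simp only [g, D.node_zero, D.node_last, Sum.inl.injEq]
  · rw [Finset.card_image_of_injOn hinj]
    rw [Fintype.card_sigma, Fintype.card_sum, Fintype.card_sigma] at hcard
    simp only [Fintype.card_fin] at hcard
    -- An edge has one more segment than bends, so the bends cancel from the inequality.
    have : ∑ e, D.n e = ∑ e, (D.n e - 1) + Fintype.card E := by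
      rw [← Finset.card_univ, Finset.card_eq_sum_ones, ← Finset.sum_add_distrib]
      exact Finset.sum_congr rfl fun e _ => by have := D.n_pos e; omega
    omega
  · intro e
    rw [Finset.filter_image]
    exact Finset.card_image_le.trans (htwo _)

end PolylineDrawing

/-! ### The Euler bound -/

namespace SimpleGraph

/-- A nonempty set of edges without ends has at least four elements or is a triangle. -/
theorem four_le_card_or_triangle {V : Type*} [DecidableEq V] (G : SimpleGraph V)
    (F : Finset (Sym2 V)) (hF : ∀ e ∈ F, e ∈ G.edgeSet) (hne : F.Nonempty)
    (hdeg : ∀ e ∈ F, ∀ w ∈ e, ∃ f ∈ F, f ≠ e ∧ w ∈ f) :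
    4 ≤ F.card ∨ (F.card = 3 ∧ ∃ a b c, G.Adj a b ∧ G.Adj a c ∧ G.Adj b c ∧
      F = {s(a, b), s(a, c), s(b, c)}) := by
  have hnext : ∀ a b, s(a, b) ∈ F → ∃ c, c ≠ a ∧ s(b, c) ∈ F := by
    intro a b h
    obtain ⟨f, hf, hfe, hbf⟩ := hdeg _ h b (Sym2.mem_mk_right a b)
    obtain ⟨c, rfl⟩ := Sym2.mem_iff_exists.1 hbf
    exact ⟨c, fun hc => hfe (by rw [hc, Sym2.eq_swap]), hf⟩
  obtain ⟨e, he⟩ := hne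
  induction e with | _ a b => ?_
  have hadj : ∀ {a b}, s(a, b) ∈ F → G.Adj a b := fun h => hF _ h
  have hab := hadj he
  obtain ⟨c, hca, hbc⟩ := hnext a b he
  obtain ⟨d, hdb, had⟩ := hnext b a (by rwa [Sym2.eq_swap])
  have hbc' := hadj hbc
  have had' := hadj had
  have n1 := hab.ne
  have n2 := hbc'.ne
  have n3 := had'.ne
  rcases Nat.lt_or_ge F.card 4 with hlt | hge
  swap
  · exact Or.inl hge
  right
  -- These edges are distinct even if `c = d`. If there are no others, the edge that continues from
  -- `c` must be `ad`, so `c = d`.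
  have hcard : ({s(a, b), s(a, d), s(b, c)} : Finset (Sym2 V)).card = 3 := by
    rw [Finset.card_eq_three]
    refine ⟨_, _, _, ?_, ?_, ?_, rfl⟩ <;> simp only [ne_eq, Sym2.eq_iff] <;> grind
  have hsub : ({s(a, b), s(a, d), s(b, c)} : Finset (Sym2 V)) ⊆ F := by
    intro z hz
    simp only [Finset.mem_insert, Finset.mem_singleton] at hz
    rcases hz with rfl | rfl | rfl <;> assumption
  have hFeq := Finset.eq_of_subset_of_card_le hsub (by omega)
  obtain ⟨f, hfb, hcf⟩ := hnext b c hbc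
  rw [← hFeq] at hcf
  simp only [Finset.mem_insert, Finset.mem_singleton, Sym2.eq_iff] at hcf
  have hcd : c = d := by grind
  subst hcd
  exact ⟨by rw [← hFeq, hcard], a, b, c, hab, had', hbc', hFeq.symm⟩

/-- The polygonal lines of a plane drawing. The isolated vertices are left out. -/
theorem exists_polylineDrawing {V : Type*} (G : SimpleGraph V) (hG : G.IsPlanar) :
    ∃ D : PolylineDrawing {v // ∃ w, G.Adj v w} G.edgeSet,
      ∀ e : G.edgeSet, (e : Sym2 V) = s((D.u e : V), (D.v e : V)) := by
  obtain ⟨P⟩ := hG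
  have h1 : ∀ e : G.edgeSet, ∃ u v, G.Adj u v ∧ (e : Sym2 V) = s(u, v) := by
    rintro ⟨e, he⟩
    induction e with | _ a b => exact ⟨a, b, he, rfl⟩
  choose u v huv he using h1
  have h2 := fun e => P.isPolygonalArc (u e) (v e) (huv e)
  choose n x hn hx0 hxn hne hself harc using h2
  have hmem : ∀ e i y, i < n e → y ∈ segment ℝ (x e i) (x e (i + 1)) → y ∈ P.arc e := by
    intro e i y hi hy
    rw [he, harc]
    exact ⟨i, hi, hy⟩
  refine ⟨{
    point := fun w => P.point w
    u := fun e => ⟨u e, v e, huv e⟩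
    v := fun e => ⟨v e, u e, (huv e).symm⟩
    n := n
    x := x
    point_injective := P.point_injective.comp Subtype.val_injective
    n_pos := hn
    x_zero := hx0
    x_last := hxn
    x_ne := hne
    self_inter := hself
    vertex_mem := ?_
    inter := ?_ }, he⟩
  · intro e i w hi hw
    have := P.vertex_mem_arc e e.2 w (hmem e i _ hi hw)
    rw [he, Sym2.mem_iff] at this
    exact this.imp Subtype.ext Subtype.ext
  · intro e f hef i j hi hj y hy1 hy2
    obtain ⟨w, hw1, hw2, hw3⟩ := P.arc_inter e e.2 f f.2 (fun h => hef (Subtype.ext h)) y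
      (hmem e i y hi hy1) (hmem f j y hj hy2)
    rw [he, Sym2.mem_iff] at hw1 hw2
    have hw : ∃ w', G.Adj w w' := by
      rcases hw1 with rfl | rfl
      · exact ⟨_, huv e⟩
      · exact ⟨_, (huv e).symm⟩
    exact ⟨⟨w, hw⟩, hw1.imp Subtype.ext Subtype.ext, hw2.imp Subtype.ext Subtype.ext, hw3⟩

/-- Euler's bound for the number of edges of a planar graph, with a correction for triangles. -/
theorem IsPlanar.two_mul_card_edges_le {V : Type*} [Fintype V] [DecidableEq V]
    (G : SimpleGraph V) [DecidableRel G.Adj] (hG : G.IsPlanar) : 2 * G.edgeFinset.card ≤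
      4 * ({v | 0 < G.degree v} : Finset V).card + (G.cliqueFinset 3).card := by
  classical
  obtain ⟨D, hD⟩ := G.exists_polylineDrawing hG
  obtain ⟨B, hB, hcard, htwo⟩ := D.exists_two_basis
  have hE : G.edgeFinset.card = Fintype.card G.edgeSet := by
    rw [edgeFinset, Set.toFinset_card]
  have hV : Fintype.card {v // ∃ w, G.Adj v w} = ({v | 0 < G.degree v} : Finset V).card := by
    rw [Fintype.card_subtype]
    congr 1
    ext v
    simp [degree_pos_iff_exists_adj]
  let supp : (G.edgeSet → ZMod 2) → Finset G.edgeSet := fun C => {e | C e ≠ 0}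
  let F : (G.edgeSet → ZMod 2) → Finset (Sym2 V) := fun C => (supp C).map ⟨_, Subtype.val_injective⟩
  have hFcard : ∀ C, (F C).card = (supp C).card := fun C => Finset.card_map _
  have hFinj : Function.Injective F := by
    intro C C' h
    have h1 : supp C = supp C' := Finset.map_injective _ h
    funext e
    have h2 : e ∈ supp C ↔ e ∈ supp C' := by rw [h1]
    simp only [supp, Finset.mem_filter, Finset.mem_univ, true_and] at h2
    generalize C e = p at *
    generalize C' e = q at *
    revert p q
    decide
  have hcases : ∀ C ∈ B, 4 ≤ (F C).card ∨ ((F C).card = 3 ∧ ∃ a b c, G.Adj a b ∧ G.Adj a c ∧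
      G.Adj b c ∧ F C = {s(a, b), s(a, c), s(b, c)}) := by
    intro C hC
    obtain ⟨h0, hcyc⟩ := hB C hC
    apply G.four_le_card_or_triangle
    · intro e he
      obtain ⟨e, -, rfl⟩ := Finset.mem_map.1 he
      exact e.2
    · obtain ⟨e, he⟩ := Function.ne_iff.1 h0
      exact ⟨e, Finset.mem_map.2 ⟨e, by simpa [supp] using he, rfl⟩⟩
    · intro e he' w hw
      obtain ⟨e, he, rfl⟩ := Finset.mem_map.1 he'
      simp only [supp, Finset.mem_filter, Finset.mem_univ, true_and] at he
      -- If `e` were the only edge of the support at `w`, the boundary at `w` would be `C e ≠ 0`.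
      by_contra! hcon
      have hadj : s((D.u e : V), (D.v e : V)) ∈ G.edgeSet := hD e ▸ e.2
      have hne : D.u e ≠ D.v e := fun h => G.loopless.irrefl (D.u e : V) (by rw [← h] at hadj; exact hadj)
      change w ∈ (e : Sym2 V) at hw
      have hw' : ∃ w' : {v // ∃ w, G.Adj v w}, w = w' := by
        rw [hD e, Sym2.mem_iff] at hw
        rcases hw with h | h
        · exact ⟨_, h⟩
        · exact ⟨_, h⟩
      obtain ⟨w, rfl⟩ := hw'
      have hiff : ∀ f : G.edgeSet, (w : V) ∈ (f : Sym2 V) ↔ D.u f = w ∨ D.v f = w := by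
        intro f
        rw [hD f, Sym2.mem_iff, Subtype.ext_iff, Subtype.ext_iff]
        tauto
      have hsum := hcyc w
      rw [Finset.sum_eq_single e] at hsum
      · rcases (mul_eq_zero.1 hsum) with h | h
        · rcases (hiff e).1 hw with h1 | h1
          · have : D.v e ≠ w := fun h2 => hne (h1.trans h2.symm)
            simp [h1, this] at h
          · have : D.u e ≠ w := fun h2 => hne (h2.trans h1.symm)
            simp [h1, this] at h
        · exact he h
      · intro f _ hfe
        by_cases hf : C f = 0
        · rw [hf, mul_zero]
        · have := hcon f (Finset.mem_map.2 ⟨f, by simpa [supp] using hf, rfl⟩)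
            (fun h => hfe (Subtype.ext h))
          rw [hiff] at this
          push Not at this
          simp [this.1, this.2]
      · simp
  -- Members with three edges are determined by their triangles, since `F` is injective.
  have hT : ({C ∈ B | (F C).card = 3}).card ≤ (G.cliqueFinset 3).card := by
    rw [← Finset.card_image_of_injective _ hFinj]
    refine (Finset.card_le_card (t := (G.cliqueFinset 3).image
      fun t => t.sym2.filter fun z => ¬ z.IsDiag) ?_).trans Finset.card_image_le
    intro X hX
    obtain ⟨C, hC, rfl⟩ := Finset.mem_image.1 hX
    rw [Finset.mem_filter] at hC
    rcases hcases C hC.1 with h | ⟨-, a, b, c, hab, hac, hbc, h⟩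
    · omega
    · refine Finset.mem_image.2 ⟨{a, b, c}, ?_, ?_⟩
      · rw [mem_cliqueFinset_iff, is3Clique_triple_iff]
        exact ⟨hab, hac, hbc⟩
      · rw [h]
        have n1 := hab.ne
        have n2 := hac.ne
        have n3 := hbc.ne
        ext z
        induction z with | _ p q => ?_
        simp only [Finset.mem_filter, Finset.mk_mem_sym2_iff, Finset.mem_insert,
          Finset.mem_singleton, Sym2.mk_isDiag_iff, Sym2.eq_iff]
        grind
  have h4 : 4 * B.card ≤ ∑ C ∈ B, (F C).card + ({C ∈ B | (F C).card = 3}).card := by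
    rw [Finset.card_filter, ← Finset.sum_add_distrib, mul_comm, ← smul_eq_mul]
    apply Finset.card_nsmul_le_sum
    intro C hC
    rcases hcases C hC with h | ⟨h, -⟩
    · omega
    · simp [h]
  have h5 : ∑ C ∈ B, (F C).card ≤ 2 * Fintype.card G.edgeSet := by
    simp only [hFcard, supp, Finset.card_filter]
    rw [Finset.sum_comm, mul_comm, ← smul_eq_mul, ← Finset.card_univ]
    apply Finset.sum_le_card_nsmul
    intro e _
    rw [← Finset.card_filter]
    exact htwo e
  omega

end SimpleGraph

/-! ### Discharging -/

namespace SimpleGraph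

variable {V : Type*} [Fintype V] (G : SimpleGraph V) [DecidableRel G.Adj]

/-- The number of neighbours of degree three. -/
def cubicNeighbors (v : V) : ℕ := ((G.neighborFinset v).filter fun u => G.degree u = 3).card

/-- Double counting: the charge sent to cubic vertices equals the charge they receive. -/
theorem sum_cubicNeighbors :
    ∑ v, G.cubicNeighbors v = ∑ v, if G.degree v = 3 then 3 else 0 := by
  have h1 : ∀ v, G.cubicNeighbors v = ∑ u, if G.Adj v u ∧ G.degree u = 3 then 1 else 0 := by
    intro v
    rw [cubicNeighbors, ← Finset.card_filter]
    congr 1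
    ext u
    simp
  simp only [h1]
  rw [Finset.sum_comm]
  refine Finset.sum_congr rfl fun u _ => ?_
  by_cases h : G.degree u = 3
  · simp only [h, and_true, if_true]
    rw [← Finset.card_filter, ← h, ← card_neighborFinset_eq_degree]
    congr 1
    ext v
    simp [G.adj_comm]
  · simp [h]

/-- The charge that the triangle `τ` gets from its vertex `v`. -/
def triangleCharge (τ : Finset V) (v : V) : ℕ :=
  if G.degree v ≤ 4 then 0 else if ∃ u ∈ τ, G.degree u ≤ 4 then 3 else 2

theorem triangleCharge_le (τ : Finset V) (v : V) : G.triangleCharge τ v ≤ 3 := by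
  unfold triangleCharge
  split_ifs <;> norm_num

variable [DecidableEq V]

theorem exists_eq_of_mem_cliqueFinset_three {τ : Finset V} (hτ : τ ∈ G.cliqueFinset 3) {v x : V}
    (hv : v ∈ τ) (hx : x ∈ τ) (hvx : v ≠ x) :
    ∃ c, G.Adj v x ∧ G.Adj v c ∧ G.Adj x c ∧ τ = {v, x, c} := by
  rw [mem_cliqueFinset_iff] at hτ
  have h1 : ((τ.erase v).erase x).card = 1 := by
    rw [Finset.card_erase_of_mem (Finset.mem_erase.2 ⟨hvx.symm, hx⟩), Finset.card_erase_of_mem hv,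
      hτ.card_eq]
  obtain ⟨c, hc⟩ := Finset.card_eq_one.1 h1
  have hτ' : τ = {v, x, c} := by
    rw [← hc, Finset.insert_erase (Finset.mem_erase.2 ⟨hvx.symm, hx⟩), Finset.insert_erase hv]
  have h2 := hτ
  rw [hτ', is3Clique_triple_iff] at h2
  exact ⟨c, h2.1, h2.2.1, h2.2.2, hτ'⟩

/-- In a graph without kites, triangles at `v` have no other vertex in common. -/
theorem sum_card_filter_erase_le (hG : ¬ G.ContainsKite) (v : V) (Q : V → Prop) [DecidablePred Q] :
    ∑ τ ∈ G.cliqueFinset 3 with v ∈ τ, ((τ.erase v).filter Q).card ≤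
      ((G.neighborFinset v).filter Q).card := by
  rw [← Finset.card_biUnion]
  · apply Finset.card_le_card
    intro x hx
    simp only [Finset.mem_biUnion, Finset.mem_filter, Finset.mem_erase] at hx
    obtain ⟨τ, ⟨hτ, hv⟩, ⟨hxv, hx⟩, hQ⟩ := hx
    obtain ⟨c, h, -⟩ := G.exists_eq_of_mem_cliqueFinset_three hτ hv hx hxv.symm
    rw [Finset.mem_filter, mem_neighborFinset]
    exact ⟨h, hQ⟩
  · intro τ hτ σ hσ hne
    rw [Finset.mem_coe, Finset.mem_filter] at hτ hσ
    refine Finset.disjoint_left.2 fun x hx hx' => ?_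
    simp only [Finset.mem_filter, Finset.mem_erase] at hx hx'
    obtain ⟨c, h1, h2, h3, e1⟩ :=
      G.exists_eq_of_mem_cliqueFinset_three hτ.1 hτ.2 hx.1.2 hx.1.1.symm
    obtain ⟨d, -, h4, h5, e2⟩ :=
      G.exists_eq_of_mem_cliqueFinset_three hσ.1 hσ.2 hx'.1.2 hx'.1.1.symm
    exact hG ⟨v, x, c, d, fun h => hne (by rw [e1, e2, h]), h1, h2, h3, h4, h5⟩

theorem two_mul_card_triangles_le (hG : ¬ G.ContainsKite) (v : V) :
    2 * ({τ ∈ G.cliqueFinset 3 | v ∈ τ}).card ≤ G.degree v := by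
  have h := G.sum_card_filter_erase_le hG v (fun _ => True)
  rw [Finset.filter_true, card_neighborFinset_eq_degree] at h
  refine le_trans ?_ h
  rw [mul_comm, ← smul_eq_mul]
  apply Finset.card_nsmul_le_sum
  intro τ hτ
  rw [Finset.mem_filter, mem_cliqueFinset_iff] at hτ
  rw [Finset.filter_true, Finset.card_erase_of_mem hτ.2, hτ.1.card_eq]

/-- If the vertices with property `Q` are independent, then every triangle at `v` yields a neighbour
of `v` without this property. -/
theorem card_triangles_add_card_le (hG : ¬ G.ContainsKite) (v : V) (Q : V → Prop) [DecidablePred Q]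
    (hQ : ∀ a b, G.Adj a b → Q a → ¬ Q b) :
    ({τ ∈ G.cliqueFinset 3 | v ∈ τ}).card + ((G.neighborFinset v).filter Q).card ≤ G.degree v := by
  have h := G.sum_card_filter_erase_le hG v (fun x => ¬ Q x)
  have h1 := Finset.card_filter_add_card_filter_not (s := G.neighborFinset v) Q
  rw [card_neighborFinset_eq_degree] at h1
  have h2 : ({τ ∈ G.cliqueFinset 3 | v ∈ τ}).card ≤
      ∑ τ ∈ G.cliqueFinset 3 with v ∈ τ, ((τ.erase v).filter fun x => ¬ Q x).card := by
    rw [Finset.card_eq_sum_ones]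
    apply Finset.sum_le_sum
    intro τ hτ
    rw [Finset.mem_filter] at hτ
    have hc : (τ.erase v).Nonempty := by
      rw [← Finset.card_pos, Finset.card_erase_of_mem hτ.2, ((mem_cliqueFinset_iff).1 hτ.1).card_eq]
      norm_num
    obtain ⟨x, hx⟩ := hc
    rw [Finset.mem_erase] at hx
    obtain ⟨c, h3, h4, h5, e⟩ := G.exists_eq_of_mem_cliqueFinset_three hτ.1 hτ.2 hx.2 hx.1.symm
    rw [Nat.succ_le_iff, Finset.card_pos]
    -- `x` and `c` are adjacent, so at most one of them has `Q`.
    by_cases hQx : Q x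
    · exact ⟨c, by simp [e, h4.ne', hQ _ _ h5 hQx]⟩
    · exact ⟨x, by simp [e, h3.ne', hQx]⟩
  omega

/-- At most one vertex of the triangle has degree at most 4: either the other two pay 3 each, or all
three pay 2. -/
theorem six_le_sum_triangleCharge (hlow : ∀ a b, G.Adj a b → G.degree a ≤ 4 → 4 < G.degree b)
    {τ : Finset V} (hτ : τ ∈ G.cliqueFinset 3) : 6 ≤ ∑ v ∈ τ, G.triangleCharge τ v := by
  rw [mem_cliqueFinset_iff, is3Clique_iff] at hτ
  obtain ⟨a, b, c, hab, hac, hbc, rfl⟩ := hτ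
  rw [Finset.sum_insert (by simp [hab.ne, hac.ne]), Finset.sum_insert (by simp [hbc.ne]),
    Finset.sum_singleton]
  have h1 := hlow a b hab
  have h2 := hlow a c hac
  have h3 := hlow b c hbc
  simp only [triangleCharge, Finset.mem_insert, Finset.mem_singleton, exists_eq_or_imp,
    exists_eq_left]
  split_ifs <;> omega

/-- Every vertex can pay for its neighbours of degree three and for its triangles. -/
theorem charge_le (hG : ¬ G.ContainsKite) (hΔ : 7 ≤ G.maxDegree)
    (hsum : ∀ a b, G.Adj a b → G.degree a ≤ 4 → G.maxDegree + 2 < G.degree a + G.degree b)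
    (v : V) (hv : 0 < G.degree v) :
    24 + 2 * G.cubicNeighbors v + ∑ τ ∈ G.cliqueFinset 3 with v ∈ τ, G.triangleCharge τ v +
      (if 7 ≤ G.degree v then 1 else 0) ≤
      6 * G.degree v + 2 * (if G.degree v = 3 then 3 else 0) := by
  have hmax := G.degree_le_maxDegree
  -- A vertex of degree 1 or 2 would need a neighbour of degree above `Δ`.
  have h3 : 3 ≤ G.degree v := by
    obtain ⟨u, hu⟩ := (G.degree_pos_iff_exists_adj v).1 hv
    by_contra! h
    have := hsum v u hu (by omega)
    have := hmax u
    omega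
  have hcubic : G.degree v ≤ 6 → G.cubicNeighbors v = 0 := by
    intro h
    rw [cubicNeighbors, Finset.card_eq_zero, Finset.filter_eq_empty_iff]
    intro u hu hu3
    rw [mem_neighborFinset] at hu
    have := hsum u v hu.symm (by omega)
    omega
  have ht := G.two_mul_card_triangles_le hG v
  have htc : ({τ ∈ G.cliqueFinset 3 | v ∈ τ}).card + G.cubicNeighbors v ≤ G.degree v := by
    apply G.card_triangles_add_card_le hG
    intro a b hab ha hb
    have := hsum a b hab (by omega)
    omega
  have hle3 : ∑ τ ∈ G.cliqueFinset 3 with v ∈ τ, G.triangleCharge τ v ≤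
      ({τ ∈ G.cliqueFinset 3 | v ∈ τ}).card * 3 :=
    Finset.sum_le_card_nsmul _ _ _ fun τ _ => G.triangleCharge_le τ v
  rcases Nat.lt_or_ge 4 (G.degree v) with h4 | h4
  · rcases Nat.lt_or_ge 5 (G.degree v) with h5 | h5
    · rcases Nat.lt_or_ge 6 (G.degree v) with h6 | h6
      -- With `t` triangles and `c` cubic neighbours, `2c + 3t ≤ 2d + t` and `t ≤ ⌊d/2⌋`. For `d =
      -- 7` the count is tight: `24 + 17 + 1 = 42`.
      · rw [if_pos (by omega), if_neg (by omega)]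
        omega
      · have := hcubic h6
        rw [if_neg (by omega), if_neg (by omega)]
        omega
    · have := hcubic (by omega)
      -- A neighbour of degree at most 4 would force degree at least `Δ - 1 ≥ 6` at `v`, so
      -- triangles at a vertex of degree 5 cost only 2.
      have hle2 : ∑ τ ∈ G.cliqueFinset 3 with v ∈ τ, G.triangleCharge τ v ≤
          ({τ ∈ G.cliqueFinset 3 | v ∈ τ}).card * 2 := by
        refine Finset.sum_le_card_nsmul _ _ _ fun τ hτ => ?_
        rw [Finset.mem_filter] at hτ
        unfold triangleCharge
        rw [if_neg (by omega), if_neg]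
        rintro ⟨u, hu, hu4⟩
        have huv : v ≠ u := by rintro rfl; omega
        obtain ⟨c, h, -⟩ := G.exists_eq_of_mem_cliqueFinset_three hτ.1 hτ.2 hu huv
        have := hsum u v h.symm hu4
        omega
      rw [if_neg (by omega), if_neg (by omega)]
      omega
  · have := hcubic (by omega)
    have h0 : ∑ τ ∈ G.cliqueFinset 3 with v ∈ τ, G.triangleCharge τ v = 0 :=
      Finset.sum_eq_zero fun τ _ => by rw [triangleCharge, if_pos h4]
    rw [h0, if_neg (by omega)]
    split_ifs <;> omega

theorem exists_light_edge (hplanar : G.IsPlanar) (hkite : ¬ G.ContainsKite)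
    (hdeg : 7 ≤ G.maxDegree) :
    ∃ u v, G.Adj u v ∧ G.degree u ≤ 4 ∧ G.degree u + G.degree v ≤ G.maxDegree + 2 := by
  by_contra! hsum
  have heuler := hplanar.two_mul_card_edges_le G
  have hcharge := Finset.sum_le_sum fun v (hv : v ∈ ({v | 0 < G.degree v} : Finset V)) =>
    G.charge_le hkite hdeg hsum v (Finset.mem_filter.1 hv).2
  -- Isolated vertices are excluded because they would start with charge -24; they add nothing to
  -- these sums.
  have hzero : ∀ f : V → ℕ, (∀ v, G.degree v = 0 → f v = 0) →
      ∑ v with 0 < G.degree v, f v = ∑ v, f v := by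
    intro f hf
    apply Finset.sum_subset (Finset.subset_univ _)
    intro v _ hv
    exact hf v (by simpa using hv)
  simp only [Finset.sum_add_distrib, ← Finset.mul_sum] at hcharge
  rw [Finset.sum_const, smul_eq_mul, hzero (fun v => G.degree v) (fun _ h => h),
    hzero (fun v => if G.degree v = 3 then 3 else 0) (fun v h => by simp [h]),
    hzero G.cubicNeighbors (fun v h => by
      rw [← card_neighborFinset_eq_degree, Finset.card_eq_zero] at h
      simp [cubicNeighbors, h]),
    hzero (fun v => if 7 ≤ G.degree v then 1 else 0) (fun v h => by simp [h]),
    sum_cubicNeighbors, sum_degrees_eq_twice_card_edges] at hcharge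
  have htri : 6 * (G.cliqueFinset 3).card ≤
      ∑ v with 0 < G.degree v, ∑ τ ∈ G.cliqueFinset 3 with v ∈ τ, G.triangleCharge τ v := by
    rw [hzero (fun v => ∑ τ ∈ G.cliqueFinset 3 with v ∈ τ, G.triangleCharge τ v) (fun v h =>
      Finset.sum_eq_zero fun τ _ => by rw [triangleCharge, if_pos (by omega)])]
    simp only [Finset.sum_filter]
    rw [Finset.sum_comm, mul_comm, ← smul_eq_mul]
    apply Finset.card_nsmul_le_sum
    intro τ hτ
    rw [Finset.sum_ite_mem, Finset.univ_inter]
    apply G.six_le_sum_triangleCharge _ hτ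
    intro a b hab ha
    have := hsum a b hab ha
    omega
  -- The unit kept by a vertex of maximum degree makes the total strict.
  have hbig : 0 < ∑ v, if 7 ≤ G.degree v then 1 else 0 := by
    have : Nonempty V := by
      by_contra h
      rw [not_nonempty_iff] at h
      simp at hdeg
    obtain ⟨v, hv⟩ := G.exists_maximal_degree_vertex
    rw [← Finset.card_filter, Finset.card_pos]
    exact ⟨v, by simp [← hv, hdeg]⟩
  omega

end SimpleGraph

theorem mainTheorem5 {V : Type*} [Fintype V] (G : SimpleGraph V) [DecidableRel G.Adj]
    (hplanar : G.IsPlanar) (hkite : ¬ G.ContainsKite) (hdeg : 7 ≤ G.maxDegree) :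
    ∃ u v, G.Adj u v ∧ G.degree u ≤ 4 ∧ G.degree u + G.degree v ≤ G.maxDegree + 2 := by
  classical
  exact G.exists_light_edge hplanar hkite hdeg
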